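/- Let $a,h,k\ge 1$ and $d$ be integers with $k<a$, $\gcd(a,d)=1$ and $ah+kd>a$, let $$S=\langle a,\,ah+d,\,ah+2d,\,\ldots,\,ah+kd\rangle ,$$ and assume that the listed generators form a minimal generating set of $S$ (this is automatic if $d\ge 1$). Suppose $1<k<a-2$. Conventions: for a numerical semigroup $T$ containing $a$, and $1\le i\le a-1$, let $a_i$ be the smallest element of $T$ congruent to $i$ modulo $a$ and write $a_i=az_i+i$; $(a_i)$ is the Apéry tuple and $(z_i)$ the Kunz tuple of $T$. Let $\mathcal C(\mathbb Z_a)\subset\mathbb R^{a-1}$ be the cone given by $x_i+x_j\ge x_{i+j}$ for all $i,j\in\mathbb Z_a\setminus\{0\}$ with $i+j\neq 0$. A face of $\mathcal C(\mathbb Z_a)$ contains $T$ if the Apéry tuple of $T$ lies in the relative interior of the face. Then there is exactly one face $F$ of $\mathcal C(\mathbb Z_a)$ containing $S$; it has dimension $2$, and its extremal rays are exactly the two distinct rays spanned by the following vectors: (i) the vector $\vec r$ that, when added to the Kunz tuple of $S$, yields the Kunz tuple of the numerical semigroup $\langle a,\,ah+(d+a),\,\ldots,\,ah+k(d+a)\rangle$;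 (ii) the vector $\vec t$ that, when added to the Kunz tuple of $S$, yields the Kunz tuple of the numerical semigroup $\langle a,\,a(h+a)+(d-a\lfloor a/k\rfloor),\,\ldots,\,a(h+a)+k(d-a\lfloor a/k\rfloor)\rangle$. Here the parameters $(a,h,k,d+a)$ and $(a,h+a,k,d-a\lfloor a/k\rfloor)$ of these two semigroups again satisfy the conditions imposed on $(a,h,k,d)$ in the first sentence (apart from the minimality assumption). The ray spanned by $\vec r$ contains all numerical semigroups $\langle a,b\rangle$ with $b$ positive and $b\equiv d \bmod a$. If $k\mid(a-1)$, then the ray spanned by $\vec t$ contains numerical semigroups, and each of them has the form $\langle a,b\rangle$ for some positive $b\equiv kd\bmod a$. -/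

import Mathlib

/-- A numerical semigroup is an additive submonoid of `ℕ` with finite complement. -/
def IsNumericalSemigroup (S : AddSubmonoid ℕ) : Prop :=
  ((S : Set ℕ)ᶜ).Finite

/-- The Apéry set `Ap(S; m)`: the elements `n` of `S` with `n - m ∉ S`. -/
def aperySet (S : AddSubmonoid ℕ) (m : ℕ) : Set ℕ :=
  {n | n ∈ S ∧ ∀ s ∈ S, s + m ≠ n}

/-- If `S` is a numerical semigroup containing `m ≥ 1`, then `Ap(S; m)` has exactly one element
in each residue class modulo `m`. -/
theorem existsUnique_aperySet (S : AddSubmonoid ℕ) (m : ℕ) (hm : 0 < m)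
    (hS : IsNumericalSemigroup S) (hmS : m ∈ S) (g : ZMod m) :
    ∃! n : ℕ, n ∈ aperySet S m ∧ (n : ZMod m) = g := by
  have : NeZero m := ⟨hm.ne'⟩
  have hex : ∃ n : ℕ, n ∈ S ∧ (n : ZMod m) = g := by
    by_contra hcon
    push Not at hcon
    apply Set.infinite_of_injective_forall_mem (f := fun j : ℕ => g.val + m * j)
      (s := ((S : Set ℕ)ᶜ)) _ _ hS
    · intro i j hij
      have h1 : m * i = m * j := Nat.add_left_cancel hij
      exact Nat.eq_of_mul_eq_mul_left hm h1
    · intro j hj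
      exact hcon _ hj (by simp)
  classical
  have hmin := fun n (hn : n ∈ S ∧ (n : ZMod m) = g) => Nat.find_min' hex hn
  obtain ⟨h1, h2⟩ := Nat.find_spec hex
  refine ⟨Nat.find hex, ⟨⟨h1, ?_⟩, h2⟩, ?_⟩
  · intro s hs hsm
    have := hmin s ⟨hs, by rw [← h2, ← hsm]; simp⟩
    omega
  · rintro n ⟨⟨hn, hn'⟩, hng⟩
    have hle := hmin n ⟨hn, hng⟩
    have hdvd : m ∣ n - Nat.find hex :=
      (Nat.modEq_iff_dvd' hle).1 ((ZMod.natCast_eq_natCast_iff _ _ _).1 (h2.trans hng.symm))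
    obtain ⟨c, hc⟩ := hdvd
    rcases c with _ | c
    · simp at hc; omega
    · exfalso
      refine hn' (Nat.find hex + c • m) (S.add_mem h1 (S.nsmul_mem hmS c)) ?_
      have : m * (c + 1) = c * m + m := by ring
      simp only [smul_eq_mul]
      omega

/-- The Apéry coordinate of `S` in the residue class `g`: the element of `Ap(S; m)` that is
congruent to `g` modulo `m`. -/
noncomputable def aperyCoord (m : ℕ) (S : AddSubmonoid ℕ) (g : ZMod m) : ℕ :=
  sInf {n : ℕ | n ∈ aperySet S m ∧ (n : ZMod m) = g}

/-- The Apéry tuple `(a_1, …, a_{m-1})` of `S`, indexed by the nonzero residues modulo `m`. -/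
noncomputable def aperyTuple (m : ℕ) (S : AddSubmonoid ℕ) : {g : ZMod m // g ≠ 0} → ℝ :=
  fun g => (aperyCoord m S g.1 : ℝ)

/-- The Kunz tuple `(z_1, …, z_{m-1})` of `S`, where `a_i = m z_i + i` for `1 ≤ i ≤ m - 1`. -/
noncomputable def kunzTuple (m : ℕ) (S : AddSubmonoid ℕ) : {g : ZMod m // g ≠ 0} → ℝ :=
  fun g => ((aperyCoord m S g.1 : ℝ) - (g.1.val : ℝ)) / (m : ℝ)

/-- The group cone `𝒞(G)`: `x_i + x_j ≥ x_{i+j}` for all `i, j ≠ 0` with `i + j ≠ 0`. -/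
def groupCone (G : Type*) [AddCommGroup G] : Set ({g : G // g ≠ 0} → ℝ) :=
  {x | ∀ i j : {g : G // g ≠ 0}, ∀ hij : i.1 + j.1 ≠ 0, x ⟨i.1 + j.1, hij⟩ ≤ x i + x j}

/-- A face of `𝒞(G)`: the subset of `𝒞(G)` on which the inequalities indexed by some collection
`E` of pairs hold with equality. -/
def IsConeFace (G : Type*) [AddCommGroup G] (F : Set ({g : G // g ≠ 0} → ℝ)) : Prop :=
  ∃ E : Set ({g : G // g ≠ 0} × {g : G // g ≠ 0}),
    F = {x | x ∈ groupCone G ∧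
      ∀ p ∈ E, ∀ hp : p.1.1 + p.2.1 ≠ 0, x p.1 + x p.2 = x ⟨p.1.1 + p.2.1, hp⟩}

/-- The dimension of a face: the dimension of its affine span. -/
noncomputable def faceDim {ι : Type*} (F : Set (ι → ℝ)) : ℕ :=
  Module.finrank ℝ (vectorSpan ℝ F)

/-- The relative interior of a face `F` of `𝒞(G)`: the points of `F` that lie in no face properly
contained in `F`. -/
def relInterior (G : Type*) [AddCommGroup G] (F : Set ({g : G // g ≠ 0} → ℝ)) :
    Set ({g : G // g ≠ 0} → ℝ) :=
  {x | x ∈ F ∧ ∀ F', IsConeFace G F' → F' ⊂ F → x ∉ F'}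

/-- `R` is an extremal ray of the face `F` of `𝒞(G)`: an unbounded one-dimensional face of `𝒞(G)`
contained in `F`. -/
def IsExtremalRay (G : Type*) [AddCommGroup G] (F R : Set ({g : G // g ≠ 0} → ℝ)) : Prop :=
  IsConeFace G R ∧ R ⊆ F ∧ faceDim R = 1 ∧ ¬ Bornology.IsBounded R

/-- The set of nonnegative multiples of a vector. -/
def raySpan {ι : Type*} (v : ι → ℝ) : Set (ι → ℝ) :=
  {x | ∃ c : ℝ, 0 ≤ c ∧ x = c • v}

/-- The face `F` of `𝒞(ℤ/m)` contains the numerical semigroup `S` (with `m ∈ S`): the Apéry tuple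
of `S` lies in the relative interior of `F`. -/
def FaceContains (m : ℕ) (F : Set ({g : ZMod m // g ≠ 0} → ℝ)) (S : AddSubmonoid ℕ) : Prop :=
  IsConeFace (ZMod m) F ∧ IsNumericalSemigroup S ∧ m ∈ S ∧
    aperyTuple m S ∈ relInterior (ZMod m) F

/-- `z` is the Kunz tuple (with respect to `m`) of the numerical semigroup `S`. -/
def IsKunzTupleOf (m : ℕ) (z : {g : ZMod m // g ≠ 0} → ℝ) (S : AddSubmonoid ℕ) : Prop :=
  IsNumericalSemigroup S ∧ m ∈ S ∧ z = kunzTuple m S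

/-- The generators `a, ah + d, ah + 2d, …, ah + kd`. -/
def arithGens (a h k : ℕ) (d : ℤ) : Set ℕ :=
  {n | n = a ∨ ∃ i : ℕ, 1 ≤ i ∧ i ≤ k ∧ (n : ℤ) = a * h + i * d}

/-- The semigroup `⟨a, ah + d, ah + 2d, …, ah + kd⟩`. -/
def arithSemigroup (a h k : ℕ) (d : ℤ) : AddSubmonoid ℕ :=
  AddSubmonoid.closure (arithGens a h k d)

/-- The conditions on the parameters of an extra-generalized arithmetical numerical semigroup.
They make every number `ah + id` with `0 ≤ i ≤ k` positive. -/
structure IsExtraGenArith (a h k : ℕ) (d : ℤ) : Prop where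
  one_le_a : 1 ≤ a
  one_le_h : 1 ≤ h
  one_le_k : 1 ≤ k
  k_lt_a : k < a
  gcd_eq_one : Int.gcd a d = 1
  lt_last : (a : ℤ) < a * h + k * d

/-- No element of `A` lies in the semigroup generated by the other elements of `A`. -/
def IsMinimalGenSet (A : Set ℕ) : Prop :=
  ∀ x ∈ A, x ∉ AddSubmonoid.closure (A \ {x})

/-! Write each nonzero residue as `n * d` with `0 < n < a`, and put `q = ⌊a / k⌋`. Everything rests
on the formula `a * h * ⌈n / k⌉ + n * d` for the Apéry element (`aperyCoord_arithSemigroup`), valid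
once `q * h + d ≥ 0`; minimality of the generators makes this number positive. The formula regroups
as `(q * h + d) * n + h * (a * ⌈n / k⌉ - q * n)`, a strictly positive combination of `indexRay` and
`ceilRay`.

Both vectors lie in the group cone. Their common tight equations include additivity at every pair
where `⌈· / k⌉` is additive without wrapping around modulo `a`, and for `1 < k < a - 2` this already
leaves only the functions `u * ⌈n / k⌉ + n * δ` (`exists_eq_ceilDiv_of_additive`). Inside this
plane, the inequality for `1 + 1 = 2` gives `u ≥ 0` and the one for `k + (a + 1 - k) ≡ 1` gives `u *
q + a * δ ≥ 0`, which says exactly that the point is in the cone spanned by the two vectors. So that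
cone is a face, the smallest one containing the Apéry tuple, and making either inequality tight
gives one of its rays.

Replacing `(h, d)` by `(h, d + a)` or `(h + a, d - a * q)` preserves `q * h + d ≥ 0`, so the same
formula identifies the two shifted Kunz tuples. If `k ∣ a - 1`, then `ceilRay` for `d` is `indexRay`
for `k * d`, whose ray carries the semigroups `⟨a, b⟩`. -/

theorem aperyCoord_spec {m : ℕ} {S : AddSubmonoid ℕ} (hm : 0 < m)
    (hS : IsNumericalSemigroup S) (hmS : m ∈ S) (g : ZMod m) :
    aperyCoord m S g ∈ aperySet S m ∧ (aperyCoord m S g : ZMod m) = g := by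
  obtain ⟨n, hn, -⟩ := existsUnique_aperySet S m hm hS hmS g
  exact Nat.sInf_mem (s := {n : ℕ | n ∈ aperySet S m ∧ (n : ZMod m) = g}) ⟨n, hn⟩

theorem aperyCoord_eq_of_isLeast {m : ℕ} {S : AddSubmonoid ℕ} (hm : 0 < m)
    (hS : IsNumericalSemigroup S) (hmS : m ∈ S) {g : ZMod m} {w : ℕ} (hw : w ∈ S)
    (hwg : (w : ZMod m) = g) (hmin : ∀ s ∈ S, (s : ZMod m) = g → w ≤ s) :
    aperyCoord m S g = w := by
  refine (existsUnique_aperySet S m hm hS hmS g).unique (aperyCoord_spec hm hS hmS g)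
    ⟨⟨hw, fun s hs hsw => ?_⟩, hwg⟩
  have := hmin s hs (by rw [← hwg, ← hsw]; simp)
  omega

theorem aperyCoord_le {m : ℕ} {S : AddSubmonoid ℕ} (hm : 0 < m)
    (hS : IsNumericalSemigroup S) (hmS : m ∈ S) {s : ℕ} (hs : s ∈ S) :
    aperyCoord m S (s : ZMod m) ≤ s := by
  classical
  have hex : ∃ n : ℕ, n ∈ S ∧ (n : ZMod m) = s := ⟨s, hs, rfl⟩
  rw [aperyCoord_eq_of_isLeast hm hS hmS (Nat.find_spec hex).1 (Nat.find_spec hex).2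
    fun n hn hns => Nat.find_min' hex ⟨hn, hns⟩]
  exact Nat.find_min' hex ⟨hs, rfl⟩

theorem mem_of_natCast_eq {m : ℕ} {S : AddSubmonoid ℕ} (hmS : m ∈ S) {w n : ℕ} (hw : w ∈ S)
    (hle : w ≤ n) (hwn : (w : ZMod m) = n) : n ∈ S := by
  obtain ⟨c, hc⟩ := (Nat.modEq_iff_dvd' hle).1 ((ZMod.natCast_eq_natCast_iff _ _ _).1 hwn)
  have : n = w + c • m := by rw [smul_eq_mul, mul_comm]; omega
  rw [this]
  exact S.add_mem hw (S.nsmul_mem hmS c)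

theorem isNumericalSemigroup_of_forall_residue {m : ℕ} {S : AddSubmonoid ℕ} (hm : 0 < m)
    (hmS : m ∈ S) (h : ∀ g : ZMod m, ∃ n ∈ S, (n : ZMod m) = g) : IsNumericalSemigroup S := by
  have : NeZero m := ⟨hm.ne'⟩
  choose f hf hfg using h
  refine (Set.finite_iUnion fun g : ZMod m => Set.finite_Iio (f g)).subset fun n hn => ?_
  refine Set.mem_iUnion.2 ⟨n, ?_⟩
  by_contra hlt
  exact hn (mem_of_natCast_eq hmS (hf n) (not_lt.1 hlt) (hfg n))

/-! ### Arithmetic of the ceiling quotient -/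

theorem ceilDiv_add_le (k i j : ℕ) (hk : 0 < k) : (i + j) ⌈/⌉ k ≤ i ⌈/⌉ k + j ⌈/⌉ k := by
  rw [ceilDiv_le_iff_le_mul hk]
  have h1 := (ceilDiv_le_iff_le_mul hk).1 (le_refl (i ⌈/⌉ k))
  have h2 := (ceilDiv_le_iff_le_mul hk).1 (le_refl (j ⌈/⌉ k))
  nlinarith

theorem ceilDiv_add_mul (k n j : ℕ) (hk : 0 < k) : (n + k * j) ⌈/⌉ k = n ⌈/⌉ k + j := by
  rw [Nat.ceilDiv_eq_add_pred_div, Nat.ceilDiv_eq_add_pred_div, ← Nat.add_mul_div_left _ _ hk]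
  congr 1
  omega

theorem ceilDiv_mono {k m n : ℕ} (hk : 0 < k) (h : m ≤ n) : m ⌈/⌉ k ≤ n ⌈/⌉ k := by
  rw [Nat.ceilDiv_eq_add_pred_div, Nat.ceilDiv_eq_add_pred_div]
  exact Nat.div_le_div_right (by omega)

theorem ceilDiv_add_div_le (k n a : ℕ) (hk : 0 < k) : n ⌈/⌉ k + a / k ≤ (n + a) ⌈/⌉ k := by
  rw [← ceilDiv_add_mul k n _ hk]
  exact ceilDiv_mono hk (Nat.add_le_add_left (Nat.mul_div_le a k) n)

theorem ceilDiv_add_mul_div_le (k n a j : ℕ) (hk : 0 < k) :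
    n ⌈/⌉ k + a / k * j ≤ (n + a * j) ⌈/⌉ k := by
  rw [← ceilDiv_add_mul k n _ hk]
  refine ceilDiv_mono hk (Nat.add_le_add_left ?_ n)
  rw [← mul_assoc]
  exact Nat.mul_le_mul_right j (Nat.mul_div_le a k)

theorem ceilDiv_eq_one {k n : ℕ} (hn : 0 < n) (hnk : n ≤ k) : n ⌈/⌉ k = 1 := by
  rw [Nat.ceilDiv_eq_add_pred_div]
  exact Nat.div_eq_of_lt_le (by omega) (by omega)

theorem add_one_ceilDiv (k a : ℕ) (hk : 0 < k) : (a + 1) ⌈/⌉ k = a / k + 1 := by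
  rw [Nat.ceilDiv_eq_add_pred_div, show a + 1 + k - 1 = a + k by omega, Nat.add_div_right _ hk]

/-! ### Elements and Apéry set of the arithmetical semigroup -/

section ArithSemigroup

variable {a h k : ℕ} {d : ℤ}

theorem self_mem_arithSemigroup (a h k : ℕ) (d : ℤ) : a ∈ arithSemigroup a h k d :=
  AddSubmonoid.subset_closure (Or.inl rfl)

theorem mul_add_mul_nonneg (hpos : 0 ≤ (a * h + k * d : ℤ)) {m n : ℕ} (hn : n ≤ k * m) :
    0 ≤ (m * (a * h) + n * d : ℤ) := by
  rcases le_total 0 d with hd | hd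
  · positivity
  · have h1 : (n : ℤ) ≤ k * m := by exact_mod_cast hn
    have h2 : (0 : ℤ) ≤ m * (a * h + k * d) := by positivity
    nlinarith

/-- A sum of `m` terms `a * h + i * d` with `0 ≤ i ≤ k` can have any total index up to `k * m`; a
term with `i = 0` is `h` copies of `a`. -/
theorem mem_arithSemigroup_of_eq (hpos : 0 ≤ (a * h + k * d : ℤ)) {m n w : ℕ} (hn : n ≤ k * m)
    (hw : (w : ℤ) = m * (a * h) + n * d) : w ∈ arithSemigroup a h k d := by
  induction m generalizing n w with
  | zero =>
    obtain rfl : n = 0 := by simpa using hn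
    obtain rfl : w = 0 := by simpa using hw
    exact zero_mem _
  | succ m ih =>
    obtain ⟨i, n', rfl, hik, hn'⟩ : ∃ i n', n = i + n' ∧ i ≤ k ∧ n' ≤ k * m := by
      -- Peeling off the largest admissible index leaves at most `k * m` for the other `m` terms.
      refine ⟨min n k, n - min n k, by omega, by omega, ?_⟩
      rw [mul_add, mul_one] at hn
      omega
    obtain ⟨w', hw'⟩ := Int.eq_ofNat_of_zero_le (mul_add_mul_nonneg hpos hn')
    obtain ⟨x, hx⟩ := Int.eq_ofNat_of_zero_le
      (mul_add_mul_nonneg (m := 1) hpos (show i ≤ k * 1 by omega))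
    have hwx : w = x + w' := by
      zify
      rw [hw, ← hx, ← hw']
      push_cast
      ring
    rw [hwx]
    refine add_mem ?_ (ih hn' hw'.symm)
    rcases Nat.eq_zero_or_pos i with rfl | hi
    · have : x = h • a := by
        rw [smul_eq_mul]
        zify
        rw [← hx]
        push_cast
        ring
      rw [this]
      exact nsmul_mem (self_mem_arithSemigroup a h k d) h
    · exact AddSubmonoid.subset_closure (Or.inr ⟨i, hi, hik, by rw [← hx]; push_cast; ring⟩)

theorem exists_eq_of_mem_arithSemigroup {s : ℕ} (hs : s ∈ arithSemigroup a h k d) :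
    ∃ c m n : ℕ, n ≤ k * m ∧ (s : ℤ) = c * a + m * (a * h) + n * d := by
  induction hs using AddSubmonoid.closure_induction with
  | mem x hx =>
    rcases hx with rfl | ⟨i, -, hik, hx⟩
    · exact ⟨1, 0, 0, by simp, by simp⟩
    · exact ⟨0, 1, i, by omega, by rw [hx]; simp⟩
  | zero => exact ⟨0, 0, 0, by simp, by simp⟩
  | add x y _ _ hx hy =>
    obtain ⟨c, m, n, hn, hx⟩ := hx
    obtain ⟨c', m', n', hn', hy⟩ := hy
    refine ⟨c + c', m + m', n + n', by rw [mul_add]; omega, ?_⟩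
    push_cast
    rw [hx, hy]
    ring

theorem isUnit_intCast_of_gcd_eq_one (hgcd : Int.gcd a d = 1) : IsUnit (d : ZMod a) := by
  rw [ZMod.coe_int_isUnit_iff_isCoprime]
  exact Int.isCoprime_iff_gcd_eq_one.2 hgcd

/-- The number `n < a` for which `g` is the residue class of `n * d`. -/
def mulIndex (a : ℕ) (d : ℤ) (g : ZMod a) : ℕ := ((d : ZMod a)⁻¹ * g).val

theorem mulIndex_lt (ha : 0 < a) (d : ℤ) (g : ZMod a) : mulIndex a d g < a :=
  have : NeZero a := ⟨ha.ne'⟩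
  ZMod.val_lt _

theorem mulIndex_mul (ha : 0 < a) (hgcd : Int.gcd a d = 1) (g : ZMod a) :
    (mulIndex a d g : ZMod a) * d = g := by
  have : NeZero a := ⟨ha.ne'⟩
  rw [mulIndex, ZMod.natCast_zmod_val, mul_right_comm,
    ZMod.inv_mul_of_unit _ (isUnit_intCast_of_gcd_eq_one hgcd), one_mul]

theorem mulIndex_natCast_mul (hgcd : Int.gcd a d = 1) {n : ℕ} (hn : n < a) :
    mulIndex a d (n * d) = n := by
  rw [mulIndex, mul_left_comm, ZMod.inv_mul_of_unit _ (isUnit_intCast_of_gcd_eq_one hgcd),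
    mul_one, ZMod.val_natCast_of_lt hn]

theorem mulIndex_pos (ha : 0 < a) (hgcd : Int.gcd a d = 1) {g : ZMod a} (hg : g ≠ 0) :
    0 < mulIndex a d g := by
  refine Nat.pos_of_ne_zero fun h0 => hg ?_
  rw [← mulIndex_mul ha hgcd g, h0]
  simp

theorem mulIndex_add (ha : 0 < a) (d : ℤ) (g g' : ZMod a) :
    mulIndex a d g + mulIndex a d g' = mulIndex a d (g + g') ∨
      mulIndex a d g + mulIndex a d g' = mulIndex a d (g + g') + a := by
  have : NeZero a := ⟨ha.ne'⟩
  have h1 := ZMod.val_lt ((d : ZMod a)⁻¹ * g)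
  have h2 := ZMod.val_lt ((d : ZMod a)⁻¹ * g')
  unfold mulIndex
  rw [mul_add, ZMod.val_add]
  rcases lt_or_ge (((d : ZMod a)⁻¹ * g).val + ((d : ZMod a)⁻¹ * g').val) a with h | h
  · left
    rw [Nat.mod_eq_of_lt h]
  · right
    rw [Nat.mod_eq_sub_mod h, Nat.mod_eq_of_lt (by omega)]
    omega

theorem exists_arithSemigroup_eq (hk : 0 < k) (hpos : 0 ≤ (a * h + k * d : ℤ)) (n : ℕ) :
    ∃ w ∈ arithSemigroup a h k d, (w : ℤ) = a * h * (n ⌈/⌉ k : ℕ) + n * d := by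
  have hn := (ceilDiv_le_iff_le_mul hk).1 (le_refl (n ⌈/⌉ k))
  obtain ⟨w, hw⟩ := Int.eq_ofNat_of_zero_le (mul_add_mul_nonneg hpos hn)
  exact ⟨w, mem_arithSemigroup_of_eq hpos hn hw.symm, by rw [← hw]; ring⟩

theorem natCast_eq_of_intCast_eq {w n : ℕ} {c : ℤ} (hw : (w : ℤ) = a * h * c + n * d) :
    (w : ZMod a) = n * d := by
  have := congrArg (Int.cast : ℤ → ZMod a) hw
  push_cast at this
  rw [this]
  simp

theorem isNumericalSemigroup_arithSemigroup (ha : 0 < a) (hk : 0 < k) (hgcd : Int.gcd a d = 1)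
    (hpos : 0 ≤ (a * h + k * d : ℤ)) : IsNumericalSemigroup (arithSemigroup a h k d) := by
  refine isNumericalSemigroup_of_forall_residue ha (self_mem_arithSemigroup a h k d) fun g => ?_
  obtain ⟨w, hwS, hw⟩ := exists_arithSemigroup_eq (a := a) hk hpos (mulIndex a d g)
  exact ⟨w, hwS, by rw [natCast_eq_of_intCast_eq hw, mulIndex_mul ha hgcd]⟩

/-- Representing the residue by a larger index `n + a * j` costs at least `q * j` further terms,
where `q = a / k`. This changes the value by at least `a * j * (q * h + d)`, which `hq` makes
nonnegative, so the index below `a` is optimal. Neither `h ≥ 1` nor `k < a` is needed, so the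
formula also covers `⟨a, b⟩`. -/
theorem aperyCoord_arithSemigroup (ha : 0 < a) (hk : 0 < k) (hgcd : Int.gcd a d = 1)
    (hpos : 0 ≤ (a * h + k * d : ℤ)) (hq : 0 ≤ ((a / k : ℕ) * h + d : ℤ)) (g : ZMod a) :
    (aperyCoord a (arithSemigroup a h k d) g : ℤ) =
      a * h * (mulIndex a d g ⌈/⌉ k : ℕ) + mulIndex a d g * d := by
  obtain ⟨w, hwS, hw⟩ := exists_arithSemigroup_eq (a := a) hk hpos (mulIndex a d g)
  rw [← hw, aperyCoord_eq_of_isLeast ha (isNumericalSemigroup_arithSemigroup ha hk hgcd hpos)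
    (self_mem_arithSemigroup a h k d) hwS]
  · rw [natCast_eq_of_intCast_eq hw, mulIndex_mul ha hgcd]
  · intro s hs hsg
    obtain ⟨c, m, n, hnm, hs⟩ := exists_eq_of_mem_arithSemigroup hs
    have hsn : (s : ZMod a) = n * d := by
      have := congrArg (Int.cast : ℤ → ZMod a) hs
      push_cast at this
      rw [this]
      simp
    have hmod : ((mulIndex a d g : ℕ) : ZMod a) = (n : ℕ) := by
      rw [← (isUnit_intCast_of_gcd_eq_one hgcd).mul_left_inj, mulIndex_mul ha hgcd, ← hsg, hsn]
    have hmod' := (ZMod.natCast_eq_natCast_iff _ _ _).1 hmod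
    -- The index below `a` is the remainder of `n` modulo `a`.
    have hle : mulIndex a d g ≤ n := by
      rw [← Nat.mod_eq_of_lt (mulIndex_lt ha d g), hmod']
      exact Nat.mod_le _ _
    obtain ⟨j, hj⟩ := (Nat.modEq_iff_dvd' hle).1 hmod'
    have hnj : n = mulIndex a d g + a * j := by omega
    have h1 : n ⌈/⌉ k ≤ m := (ceilDiv_le_iff_le_mul hk).2 hnm
    have h2 := ceilDiv_add_mul_div_le k (mulIndex a d g) a j hk
    rw [← hnj] at h2
    have h3 : ((mulIndex a d g ⌈/⌉ k : ℕ) + (a / k : ℕ) * j : ℤ) ≤ m := by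
      exact_mod_cast h2.trans h1
    zify
    rw [hw, hs, hnj]
    push_cast
    have h4 := mul_le_mul_of_nonneg_left h3 (show (0 : ℤ) ≤ a * h by positivity)
    have h5 : (0 : ℤ) ≤ a * j * ((a / k : ℕ) * h + d) := by positivity
    have h6 : (0 : ℤ) ≤ c * a := by positivity
    push_cast at h4 h5
    nlinarith

/-- Minimality of the generating set bounds a negative `d` from below. -/
theorem IsExtraGenArith.div_mul_add_pos (hS : IsExtraGenArith a h k d)
    (hmin : IsMinimalGenSet (arithGens a h k d)) (hk : 1 < k) :
    0 < ((a / k : ℕ) * h + d : ℤ) := by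
  have ha1 : 1 < a := hk.trans hS.k_lt_a
  have hh := hS.one_le_h
  have hlast := hS.lt_last
  have hq0 : 0 < a / k := Nat.div_pos hS.k_lt_a.le (by omega)
  have hdm := Nat.div_add_mod a k
  have hr := Nat.mod_lt a (show 0 < k by omega)
  generalize a / k = q at *
  generalize a % k = r at *
  have hdmz : (k * q + r : ℤ) = a := by exact_mod_cast hdm
  have hd0 : d ≠ 0 := by
    rintro rfl
    have := hS.gcd_eq_one
    simp at this
    omega
  rcases lt_or_gt_of_ne hd0 with hd | hd
  swap
  · positivity
  by_contra! hcon
  rcases Nat.eq_zero_or_pos r with rfl | hr0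
  -- If `k ∣ a`, positivity of the last generator alone gives the contradiction.
  · have h1 : (q : ℤ) * (a * h + k * d) = a * (q * h + d) := by
      rw [← hdmz]
      push_cast
      ring
    have h2 : (0 : ℤ) < q * (a * h + k * d) := by
      apply mul_pos <;> omega
    have h3 : (a : ℤ) * (q * h + d) ≤ 0 := mul_nonpos_of_nonneg_of_nonpos (by positivity) hcon
    omega
  have hpos : ∀ i : ℕ, i ≤ k → 0 ≤ (a * h + i * d : ℤ) := fun i hi => by
    have := mul_add_mul_nonneg (m := 1) (a := a) (h := h) (k := k) (d := d) (n := i) (by omega)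
      (by omega)
    simpa using this
  obtain ⟨x, hx⟩ := Int.eq_ofNat_of_zero_le (hpos 1 (by omega))
  obtain ⟨y, hy⟩ := Int.eq_ofNat_of_zero_le (hpos k le_rfl)
  obtain ⟨z, hz⟩ := Int.eq_ofNat_of_zero_le (hpos (r + 1) (by omega))
  obtain ⟨e, he⟩ := Int.eq_ofNat_of_zero_le (show (0 : ℤ) ≤ -(q * h + d) by omega)
  refine hmin x (Or.inr ⟨1, le_rfl, by omega, hx.symm⟩) ?_
  -- With `a = k * q + r` and `e = -(q * h + d) ≥ 0`, the generator `a * h + d` is `e` times `a`,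
  -- plus `q` times `a * h + k * d`, plus `a * h + (r + 1) * d`. It is therefore redundant; the
  -- index `r + 1` is at most `k`, and `r > 0` keeps the last term different from `a * h + d`.
  have hsum : x = e • a + q • y + z := by
    zify
    push_cast [smul_eq_mul]
    rw [← hx, ← hy, ← hz, ← he]
    push_cast
    linear_combination (-(d : ℤ)) * hdmz
  have hax : a ≠ x := by
    intro hax
    rw [← hax] at hx
    have h1 : (a : ℤ) ∣ d := ⟨1 - h, by push_cast at hx; linear_combination hx⟩
    have h2 := Int.gcd_eq_left (by positivity) h1
    rw [hS.gcd_eq_one] at h2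
    omega
  have hyx : y ≠ x := by
    intro hyx
    rw [hyx, ← hx] at hy
    have : ((k : ℤ) - 1) * d = 0 := by push_cast at hy; linear_combination hy
    rcases mul_eq_zero.1 this with h | h <;> omega
  have hzx : z ≠ x := by
    intro hzx
    rw [hzx, ← hx] at hz
    have : (r : ℤ) * d = 0 := by push_cast at hz; linear_combination hz
    rcases mul_eq_zero.1 this with h | h <;> omega
  have hmem : e • a + q • y + z ∈ AddSubmonoid.closure (arithGens a h k d \ {x}) := by
    have hcl : ∀ n ∈ arithGens a h k d, n ≠ x →
        n ∈ AddSubmonoid.closure (arithGens a h k d \ {x}) :=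
      fun n hn hnx => AddSubmonoid.subset_closure ⟨hn, hnx⟩
    exact add_mem (add_mem (nsmul_mem (hcl a (Or.inl rfl) hax) e)
      (nsmul_mem (hcl y (Or.inr ⟨k, by omega, le_rfl, hy.symm⟩) hyx) q))
      (hcl z (Or.inr ⟨r + 1, by omega, by omega, hz.symm⟩) hzx)
  rwa [← hsum] at hmem

end ArithSemigroup

/-! ### Faces, rays and two-dimensional cones -/

section Cone

variable {G : Type*} [AddCommGroup G] {F : Set ({g : G // g ≠ 0} → ℝ)}
  {r t x y : {g : G // g ≠ 0} → ℝ}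

theorem zero_mem_groupCone : (0 : {g : G // g ≠ 0} → ℝ) ∈ groupCone G := fun i j hij => by simp

theorem add_mem_groupCone (hx : x ∈ groupCone G) (hy : y ∈ groupCone G) :
    x + y ∈ groupCone G := fun i j hij => by
  have h1 := hx i j hij
  have h2 := hy i j hij
  simp only [Pi.add_apply]
  linarith

theorem smul_mem_groupCone {c : ℝ} (hc : 0 ≤ c) (hx : x ∈ groupCone G) :
    c • x ∈ groupCone G := fun i j hij => by
  have h1 := mul_le_mul_of_nonneg_left (hx i j hij) hc
  simp only [Pi.smul_apply, smul_eq_mul]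
  linarith

theorem IsConeFace.subset_groupCone (hF : IsConeFace G F) : F ⊆ groupCone G := by
  obtain ⟨E, rfl⟩ := hF
  exact fun x hx => hx.1

theorem IsConeFace.zero_mem (hF : IsConeFace G F) : 0 ∈ F := by
  obtain ⟨E, rfl⟩ := hF
  exact ⟨zero_mem_groupCone, by simp⟩

theorem IsConeFace.add_mem (hF : IsConeFace G F) (hx : x ∈ F) (hy : y ∈ F) : x + y ∈ F := by
  obtain ⟨E, rfl⟩ := hF
  refine ⟨add_mem_groupCone hx.1 hy.1, fun p hp hp0 => ?_⟩
  have h1 := hx.2 p hp hp0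
  have h2 := hy.2 p hp hp0
  simp only [Pi.add_apply]
  linarith

theorem IsConeFace.smul_mem (hF : IsConeFace G F) {c : ℝ} (hc : 0 ≤ c) (hx : x ∈ F) :
    c • x ∈ F := by
  obtain ⟨E, rfl⟩ := hF
  refine ⟨smul_mem_groupCone hc hx.1, fun p hp hp0 => ?_⟩
  simp only [Pi.smul_apply, smul_eq_mul, ← hx.2 p hp hp0, mul_add]

/-- Two nonnegative slacks with sum zero both vanish. -/
theorem IsConeFace.left_mem_of_add_mem (hF : IsConeFace G F) (hx : x ∈ groupCone G)
    (hy : y ∈ groupCone G) (hxy : x + y ∈ F) : x ∈ F := by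
  obtain ⟨E, rfl⟩ := hF
  refine ⟨hx, fun p hp hp0 => ?_⟩
  have h1 := hxy.2 p hp hp0
  have h2 := hx _ _ hp0
  have h3 := hy _ _ hp0
  simp only [Pi.add_apply] at h1
  linarith

theorem IsConeFace.mem_of_smul_mem (hF : IsConeFace G F) {c : ℝ} (hc : 0 < c)
    (hx : c • x ∈ F) : x ∈ F := by
  have := hF.smul_mem (inv_nonneg.2 hc.le) hx
  rwa [smul_smul, inv_mul_cancel₀ hc.ne', one_smul] at this

theorem mem_relInterior_of_forall_subset (hx : x ∈ F)
    (h : ∀ F', IsConeFace G F' → x ∈ F' → F ⊆ F') : x ∈ relInterior G F :=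
  ⟨hx, fun F' hF' hlt hxF' => hlt.2 (h F' hF' hxF')⟩

/-- Uniqueness of the face: if `F` is the smallest face through `x`, any other face through `x` has
`F` as a proper subface, so `x` is not in its relative interior. -/
theorem eq_of_mem_relInterior (hF : IsConeFace G F) {F' : Set ({g : G // g ≠ 0} → ℝ)}
    (hx : x ∈ F) (h : ∀ F'', IsConeFace G F'' → x ∈ F'' → F ⊆ F'') (hF' : IsConeFace G F')
    (hx' : x ∈ relInterior G F') : F' = F := by
  have hsub := h F' hF' hx'.1
  by_contra hne
  exact hx'.2 F hF (hsub.ssubset_of_ne (Ne.symm hne)) hx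

/-- The cone spanned by two vectors. -/
def coneSpan {ι : Type*} (r t : ι → ℝ) : Set (ι → ℝ) :=
  {x | ∃ α β : ℝ, 0 ≤ α ∧ 0 ≤ β ∧ x = α • r + β • t}

theorem coneSpan_subset (hF : IsConeFace G F) (hr : r ∈ F) (ht : t ∈ F) : coneSpan r t ⊆ F := by
  rintro _ ⟨α, β, hα, hβ, rfl⟩
  exact hF.add_mem (hF.smul_mem hα hr) (hF.smul_mem hβ ht)

theorem raySpan_subset (hF : IsConeFace G F) (hr : r ∈ F) : raySpan r ⊆ F := by
  rintro _ ⟨α, hα, rfl⟩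
  exact hF.smul_mem hα hr

theorem coneSpan_subset_of_mem (hr : r ∈ groupCone G) (ht : t ∈ groupCone G) {α β : ℝ}
    (hα : 0 < α) (hβ : 0 < β) (hF : IsConeFace G F) (hx : α • r + β • t ∈ F) :
    coneSpan r t ⊆ F := by
  refine coneSpan_subset hF (hF.mem_of_smul_mem hα ?_) (hF.mem_of_smul_mem hβ ?_)
  · exact hF.left_mem_of_add_mem (smul_mem_groupCone hα.le hr) (smul_mem_groupCone hβ.le ht) hx
  · rw [add_comm] at hx
    exact hF.left_mem_of_add_mem (smul_mem_groupCone hβ.le ht) (smul_mem_groupCone hα.le hr) hx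

theorem faceDim_eq_finrank_span {ι : Type*} {F : Set (ι → ℝ)} (h0 : 0 ∈ F) :
    faceDim F = Module.finrank ℝ (Submodule.span ℝ F) := by
  rw [faceDim, vectorSpan_eq_span_vsub_set_right ℝ h0]
  have : (fun x : ι → ℝ => x -ᵥ 0) '' F = F := by simp [vsub_eq_sub]
  rw [this]

theorem faceDim_raySpan {ι : Type*} {v : ι → ℝ} (hv : v ≠ 0) : faceDim (raySpan v) = 1 := by
  have h0 : 0 ∈ raySpan v := ⟨0, le_rfl, by simp⟩
  suffices Submodule.span ℝ (raySpan v) = Submodule.span ℝ {v} by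
    rw [faceDim_eq_finrank_span h0, this, finrank_span_singleton hv]
  apply le_antisymm <;> rw [Submodule.span_le]
  · rintro _ ⟨c, -, rfl⟩
    exact Submodule.smul_mem _ _ (Submodule.mem_span_singleton_self v)
  · rintro _ rfl
    exact Submodule.subset_span ⟨1, zero_le_one, by simp⟩

theorem faceDim_coneSpan {ι : Type*} {r t : ι → ℝ} (hrt : LinearIndependent ℝ ![r, t]) :
    faceDim (coneSpan r t) = 2 := by
  have h0 : 0 ∈ coneSpan r t := ⟨0, 0, le_rfl, le_rfl, by simp⟩
  suffices Submodule.span ℝ (coneSpan r t) = Submodule.span ℝ (Set.range ![r, t]) by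
    rw [faceDim_eq_finrank_span h0, this, finrank_span_eq_card hrt, Fintype.card_fin]
  apply le_antisymm <;> rw [Submodule.span_le]
  · rintro _ ⟨α, β, -, -, rfl⟩
    exact add_mem (Submodule.smul_mem _ _ (Submodule.subset_span ⟨0, rfl⟩))
      (Submodule.smul_mem _ _ (Submodule.subset_span ⟨1, rfl⟩))
  · rintro _ ⟨i, rfl⟩
    fin_cases i
    · exact Submodule.subset_span ⟨1, 0, zero_le_one, le_rfl, by simp⟩
    · exact Submodule.subset_span ⟨0, 1, le_rfl, zero_le_one, by simp⟩

theorem not_isBounded_raySpan {ι : Type*} {v : ι → ℝ} (hv : v ≠ 0) :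
    ¬ Bornology.IsBounded (raySpan v) := by
  intro hb
  obtain ⟨g, hg⟩ := Function.ne_iff.1 hv
  obtain ⟨C, hC⟩ := (hb.image_eval g).exists_norm_le
  have hg' : 0 < |v g| := abs_pos.2 hg
  have := hC (((|C| + 1) / |v g|) * v g)
    ⟨((|C| + 1) / |v g|) • v, ⟨_, by positivity, rfl⟩, by simp⟩
  rw [Real.norm_eq_abs, abs_mul, abs_of_nonneg (a := (|C| + 1) / |v g|) (by positivity),
    div_mul_cancel₀ _ hg'.ne'] at this
  linarith [le_abs_self C]

/-- A face inside the cone is determined by which of `r` and `t` it contains. Containing both gives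
dimension two and containing neither gives `{0}`, so an extremal ray contains exactly one. -/
theorem isExtremalRay_coneSpan_iff (hrt : LinearIndependent ℝ ![r, t])
    (hr : IsConeFace G (raySpan r)) (ht : IsConeFace G (raySpan t))
    {R : Set ({g : G // g ≠ 0} → ℝ)} :
    IsExtremalRay G (coneSpan r t) R ↔ R = raySpan r ∨ R = raySpan t := by
  have hr0 : r ≠ 0 := hrt.ne_zero 0
  have ht0 : t ≠ 0 := hrt.ne_zero 1
  have hrc : r ∈ groupCone G := hr.subset_groupCone ⟨1, zero_le_one, by simp⟩
  have htc : t ∈ groupCone G := ht.subset_groupCone ⟨1, zero_le_one, by simp⟩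
  constructor
  · rintro ⟨hR, hsub, hdim, -⟩
    have key : ∀ x ∈ R, ∃ α β : ℝ, 0 ≤ α ∧ 0 ≤ β ∧ x = α • r + β • t ∧ (0 < α → r ∈ R) ∧
        (0 < β → t ∈ R) := by
      intro x hx
      obtain ⟨α, β, hα, hβ, rfl⟩ := hsub hx
      refine ⟨α, β, hα, hβ, rfl, fun h => hR.mem_of_smul_mem h ?_,
        fun h => hR.mem_of_smul_mem h ?_⟩
      · exact hR.left_mem_of_add_mem (smul_mem_groupCone hα hrc) (smul_mem_groupCone hβ htc) hx
      · rw [add_comm] at hx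
        exact hR.left_mem_of_add_mem (smul_mem_groupCone hβ htc) (smul_mem_groupCone hα hrc) hx
    by_cases hrR : r ∈ R
    · by_cases htR : t ∈ R
      · rw [hsub.antisymm (coneSpan_subset hR hrR htR), faceDim_coneSpan hrt] at hdim
        omega
      · refine Or.inl (Set.Subset.antisymm (fun x hx => ?_) (raySpan_subset hR hrR))
        obtain ⟨α, β, hα, hβ, rfl, -, h2⟩ := key x hx
        obtain rfl : β = 0 := le_antisymm (not_lt.1 fun h => htR (h2 h)) hβ
        exact ⟨α, hα, by simp⟩
    · by_cases htR : t ∈ R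
      · refine Or.inr (Set.Subset.antisymm (fun x hx => ?_) (raySpan_subset hR htR))
        obtain ⟨α, β, hα, hβ, rfl, h1, -⟩ := key x hx
        obtain rfl : α = 0 := le_antisymm (not_lt.1 fun h => hrR (h1 h)) hα
        exact ⟨β, hβ, by simp⟩
      · exfalso
        have hR0 : R ⊆ {0} := fun x hx => by
          obtain ⟨α, β, hα, hβ, rfl, h1, h2⟩ := key x hx
          obtain rfl : α = 0 := le_antisymm (not_lt.1 fun h => hrR (h1 h)) hα
          obtain rfl : β = 0 := le_antisymm (not_lt.1 fun h => htR (h2 h)) hβ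
          simp
        rw [faceDim_eq_finrank_span hR.zero_mem,
          Submodule.span_eq_bot.2 fun x hx => hR0 hx, finrank_bot] at hdim
        omega
  · rintro (rfl | rfl)
    · refine ⟨hr, ?_, faceDim_raySpan hr0, not_isBounded_raySpan hr0⟩
      rintro _ ⟨c, hc, rfl⟩
      exact ⟨c, 0, hc, le_rfl, by simp⟩
    · refine ⟨ht, ?_, faceDim_raySpan ht0, not_isBounded_raySpan ht0⟩
      rintro _ ⟨c, hc, rfl⟩
      exact ⟨0, c, le_rfl, hc, by simp⟩

theorem raySpan_ne_raySpan {ι : Type*} {r t : ι → ℝ} (hrt : LinearIndependent ℝ ![r, t]) :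
    raySpan r ≠ raySpan t := by
  intro h
  obtain ⟨c, -, hc⟩ : r ∈ raySpan t := h ▸ ⟨1, zero_le_one, by simp⟩
  have := (LinearIndependent.pair_iff.1 hrt 1 (-c) (by rw [hc]; simp)).1
  exact one_ne_zero this

/-- The defining equations are all those tight at both `r` and `t`; only the inclusion of the
resulting face in the cone needs a hypothesis. -/
theorem isConeFace_coneSpan (hr : r ∈ groupCone G) (ht : t ∈ groupCone G)
    (h : ∀ x ∈ groupCone G,
      (∀ i j : {g : G // g ≠ 0}, ∀ hij : i.1 + j.1 ≠ 0, r i + r j = r ⟨i.1 + j.1, hij⟩ →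
        t i + t j = t ⟨i.1 + j.1, hij⟩ → x i + x j = x ⟨i.1 + j.1, hij⟩) →
      x ∈ coneSpan r t) : IsConeFace G (coneSpan r t) := by
  refine ⟨{p | ∀ hp : p.1.1 + p.2.1 ≠ 0, r p.1 + r p.2 = r ⟨p.1.1 + p.2.1, hp⟩ ∧
    t p.1 + t p.2 = t ⟨p.1.1 + p.2.1, hp⟩}, Set.Subset.antisymm ?_ ?_⟩
  · rintro _ ⟨α, β, hα, hβ, rfl⟩
    refine ⟨add_mem_groupCone (smul_mem_groupCone hα hr) (smul_mem_groupCone hβ ht),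
      fun p hp hp0 => ?_⟩
    obtain ⟨h1, h2⟩ := hp hp0
    simp only [Pi.add_apply, Pi.smul_apply, smul_eq_mul, ← h1, ← h2]
    ring
  · rintro x ⟨hx, hE⟩
    exact h x hx fun i j hij h1 h2 => hE (i, j) (fun _ => ⟨h1, h2⟩) hij

/-- One further equation, tight at `r` but not at `t`, forces the coefficient of `t` to vanish. -/
theorem isConeFace_raySpan_left (hF : IsConeFace G (coneSpan r t)) {i j : {g : G // g ≠ 0}}
    (hij : i.1 + j.1 ≠ 0) (hr : r i + r j = r ⟨i.1 + j.1, hij⟩)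
    (ht : t i + t j ≠ t ⟨i.1 + j.1, hij⟩) : IsConeFace G (raySpan r) := by
  obtain ⟨E, hE⟩ := hF
  refine ⟨E ∪ {(i, j)}, ?_⟩
  have : raySpan r = {x | x ∈ coneSpan r t ∧ x i + x j = x ⟨i.1 + j.1, hij⟩} := by
    refine Set.Subset.antisymm ?_ ?_
    · rintro _ ⟨c, hc, rfl⟩
      exact ⟨⟨c, 0, hc, le_rfl, by simp⟩, by simp only [Pi.smul_apply, smul_eq_mul, ← hr, mul_add]⟩
    · rintro _ ⟨⟨α, β, hα, hβ, rfl⟩, hx⟩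
      simp only [Pi.add_apply, Pi.smul_apply, smul_eq_mul, ← hr] at hx
      have : β * (t i + t j - t ⟨i.1 + j.1, hij⟩) = 0 := by linear_combination hx
      obtain rfl : β = 0 := (mul_eq_zero.1 this).resolve_right (sub_ne_zero.2 ht)
      exact ⟨α, hα, by simp⟩
  rw [this, hE]
  ext x
  constructor
  · rintro ⟨⟨hx, hxE⟩, hxij⟩
    refine ⟨hx, ?_⟩
    rintro p (hp | rfl)
    · exact hxE p hp
    · exact fun _ => hxij
  · rintro ⟨hx, hxE⟩
    exact ⟨⟨hx, fun p hp => hxE p (Or.inl hp)⟩, hxE (i, j) (Or.inr rfl) hij⟩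

theorem coneSpan_comm {ι : Type*} (r t : ι → ℝ) : coneSpan r t = coneSpan t r := by
  ext x
  constructor <;> rintro ⟨α, β, hα, hβ, rfl⟩ <;> exact ⟨β, α, hβ, hα, add_comm _ _⟩

end Cone

/-! ### The two rays and the face they span -/

section Rays

variable {a h k : ℕ} {d : ℤ}

/-- The vector whose coordinate at the residue class of `n * d` is `n`, for `0 < n < a`. -/
def indexRay (a : ℕ) (d : ℤ) : {g : ZMod a // g ≠ 0} → ℝ := fun g => mulIndex a d g.1

/-- The vector whose coordinate at the residue class of `n * d` is `a * ⌈n / k⌉ - ⌊a / k⌋ * n`,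
for `0 < n < a`. -/
def ceilRay (a k : ℕ) (d : ℤ) : {g : ZMod a // g ≠ 0} → ℝ := fun g =>
  a * (mulIndex a d g.1 ⌈/⌉ k : ℕ) - (a / k : ℕ) * mulIndex a d g.1

theorem mulIndex_congr {d' : ℤ} (hd : (d : ZMod a) = d') (g : ZMod a) :
    mulIndex a d g = mulIndex a d' g := by
  rw [mulIndex, mulIndex, hd]

theorem indexRay_congr {d' : ℤ} (hd : (d : ZMod a) = d') : indexRay a d = indexRay a d' :=
  funext fun g => by rw [indexRay, indexRay, mulIndex_congr hd]

theorem indexRay_mem_groupCone (ha : 0 < a) (d : ℤ) : indexRay a d ∈ groupCone (ZMod a) := by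
  intro i j hij
  simp only [indexRay]
  norm_cast
  have := mulIndex_add ha d i.1 j.1
  omega

theorem ceilRay_mem_groupCone (ha : 0 < a) (hk : 0 < k) (d : ℤ) :
    ceilRay a k d ∈ groupCone (ZMod a) := by
  intro i j hij
  simp only [ceilRay]
  have hc := ceilDiv_add_le k (mulIndex a d i.1) (mulIndex a d j.1) hk
  have ha' : (0 : ℝ) ≤ a := Nat.cast_nonneg a
  rcases mulIndex_add ha d i.1 j.1 with h | h <;> rw [h] at hc
  · have hc' := mul_le_mul_of_nonneg_left (Nat.cast_le (α := ℝ).2 hc) ha'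
    have h' := congrArg (Nat.cast : ℕ → ℝ) h
    push_cast at hc' h'
    rw [← h']
    linarith
  -- When the indices wrap around, the linear part loses `q * a` with `q = a / k`, and the ceiling
  -- part gains at least `a * q`.
  · have hc' := mul_le_mul_of_nonneg_left
      (Nat.cast_le (α := ℝ).2 ((ceilDiv_add_div_le k _ a hk).trans hc)) ha'
    have h' := congrArg (fun n : ℕ => ((a / k : ℕ) * n : ℝ)) h
    push_cast at hc' h'
    linarith

theorem natCast_mul_ne_zero (hgcd : Int.gcd a d = 1) {n : ℕ} (h0 : 0 < n) (hn : n < a) :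
    (n * d : ZMod a) ≠ 0 := by
  intro h
  have := mulIndex_natCast_mul hgcd hn
  rw [h] at this
  simp [mulIndex] at this
  omega

/-- A function on `{1, …, a - 1}` that is additive wherever `n ↦ ⌈n / k⌉` is additive is a linear
combination of `n ↦ ⌈n / k⌉` and `n ↦ n`. -/
theorem exists_eq_ceilDiv_of_additive (hk : 1 < k) (hka : k + 2 < a) {y : ℕ → ℝ}
    (hy : ∀ i j, 0 < i → 0 < j → i + j < a → i ⌈/⌉ k + j ⌈/⌉ k = (i + j) ⌈/⌉ k →
      y i + y j = y (i + j)) :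
    ∃ u δ : ℝ, ∀ n, 0 < n → n < a → y n = u * (n ⌈/⌉ k : ℕ) + n * δ := by
  have hk0 : 0 < k := by omega
  have hsucc : ∀ n, (n + k) ⌈/⌉ k = n ⌈/⌉ k + 1 := fun n => by
    simpa using ceilDiv_add_mul k n 1 hk0
  -- For `i, j ≤ k < i + j` the ceilings are `1 + 1 = 2`.
  have htwo : ∀ i j, 0 < i → i ≤ k → 0 < j → j ≤ k → k < i + j → i + j < a →
      y i + y j = y (i + j) := fun i j hi hik hj hjk hij hija => by
    refine hy i j hi hj hija ?_
    obtain ⟨m, hm⟩ : ∃ m, i + j = m + k := ⟨i + j - k, by omega⟩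
    rw [hm, hsucc, ceilDiv_eq_one hi hik, ceilDiv_eq_one hj hjk,
      ceilDiv_eq_one (by omega) (by omega)]
  have hsmall : ∀ m, 0 < m → m ≤ k →
      y m = (y 1 - (y (k + 2) - y (k + 1))) + m * (y (k + 2) - y (k + 1)) := by
    intro m hm
    induction m, hm using Nat.le_induction with
    | base => intro _; simp
    | succ m hm ih =>
      intro hmk
      -- Pairing `m` and `m + 1` with the same partner `k + 1 - m` gives sums `k + 1` and `k + 2`,
      -- so the increment of `y` on `1, …, k` is constant. This needs `k + 2 ≤ 2 * k` and `k + 2 <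
      -- a`.
      have h1 := htwo m (k + 1 - m) hm (by omega) (by omega) (by omega) (by omega) (by omega)
      have h2 := htwo (m + 1) (k + 1 - m) (by omega) hmk (by omega) (by omega) (by omega)
        (by omega)
      rw [show m + (k + 1 - m) = k + 1 by omega] at h1
      rw [show m + 1 + (k + 1 - m) = k + 2 by omega] at h2
      have h3 := ih (by omega)
      push_cast
      linarith
  refine ⟨y 1 - (y (k + 2) - y (k + 1)), y (k + 2) - y (k + 1), fun n => ?_⟩
  induction n using Nat.strong_induction_on with
  | _ n ih =>
    intro h0 hn
    rcases le_or_gt n k with hnk | hnk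
    · rw [ceilDiv_eq_one h0 hnk, hsmall n h0 hnk]
      simp
    -- Adding `k` always raises the ceiling by exactly one, so `y` is additive at `(m, k)`.
    · obtain ⟨m, rfl⟩ : ∃ m, n = m + k := ⟨n - k, by omega⟩
      rw [← hy m k (by omega) hk0 hn (by rw [hsucc, ceilDiv_eq_one hk0 le_rfl]),
        ih m (by omega) (by omega) (by omega), hsmall k hk0 le_rfl, hsucc]
      push_cast
      ring

theorem ceilDiv_add_one_sub (hk : 0 < k) (hka : k ≤ a) : (a + 1 - k) ⌈/⌉ k = a / k := by
  have h1 := ceilDiv_add_mul k (a + 1 - k) 1 hk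
  rw [mul_one, show a + 1 - k + k = a + 1 by omega, add_one_ceilDiv k a hk] at h1
  omega

theorem isConeFace_coneSpan_indexRay_ceilRay (hgcd : Int.gcd a d = 1) (hk : 1 < k)
    (hka : k + 2 < a) : IsConeFace (ZMod a) (coneSpan (indexRay a d) (ceilRay a k d)) := by
  have ha : 0 < a := by omega
  refine isConeFace_coneSpan (indexRay_mem_groupCone ha d)
    (ceilRay_mem_groupCone ha (by omega) d) fun x hx hE => ?_
  classical
  -- The point `x` read along the multiples of `d`; the default value `0` is never used for `0 < n <
  -- a`.
  set y : ℕ → ℝ := fun n => if hn : (n * d : ZMod a) ≠ 0 then x ⟨n * d, hn⟩ else 0 with hy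
  have hyx : ∀ (n : ℕ) (g : {g : ZMod a // g ≠ 0}), (n * d : ZMod a) = g.1 → y n = x g := by
    rintro n ⟨g, hg⟩ rfl
    exact dif_pos hg
  have hadd : ∀ i j, 0 < i → 0 < j → i + j < a → i ⌈/⌉ k + j ⌈/⌉ k = (i + j) ⌈/⌉ k →
      y i + y j = y (i + j) := by
    intro i j hi hj hij hc
    have hsum : (i * d + j * d : ZMod a) = ((i + j : ℕ) : ZMod a) * d := by push_cast; ring
    have hne := natCast_mul_ne_zero hgcd (by omega) hij
    rw [hyx i ⟨_, natCast_mul_ne_zero hgcd hi (by omega)⟩ rfl,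
      hyx j ⟨_, natCast_mul_ne_zero hgcd hj (by omega)⟩ rfl,
      hyx (i + j) ⟨i * d + j * d, by rwa [hsum]⟩ hsum.symm]
    have hc' := congrArg (Nat.cast : ℕ → ℝ) hc
    push_cast at hc'
    apply hE
    · simp only [indexRay]
      rw [hsum, mulIndex_natCast_mul hgcd (show i < a by omega),
        mulIndex_natCast_mul hgcd (show j < a by omega), mulIndex_natCast_mul hgcd hij]
      push_cast
      ring
    · simp only [ceilRay]
      rw [hsum, mulIndex_natCast_mul hgcd (show i < a by omega),
        mulIndex_natCast_mul hgcd (show j < a by omega), mulIndex_natCast_mul hgcd hij, ← hc']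
      push_cast
      ring
  obtain ⟨u, δ, hu⟩ := exists_eq_ceilDiv_of_additive hk hka hadd
  have hsub : ∀ i j m : ℕ, 0 < i → i < a → 0 < j → j < a → 0 < m → m < a →
      ((i + j : ℕ) : ZMod a) = m → y m ≤ y i + y j := by
    intro i j m hi hia hj hja hm hma hijm
    have hsum : (i * d + j * d : ZMod a) = (m : ZMod a) * d := by
      rw [← hijm]
      push_cast
      ring
    have hne := natCast_mul_ne_zero hgcd hm hma
    rw [hyx i ⟨_, natCast_mul_ne_zero hgcd hi hia⟩ rfl,
      hyx j ⟨_, natCast_mul_ne_zero hgcd hj hja⟩ rfl,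
      hyx m ⟨i * d + j * d, by rwa [hsum]⟩ hsum.symm]
    exact hx ⟨_, _⟩ ⟨_, _⟩ _
  have hu0 : 0 ≤ u := by
    have := hsub 1 1 2 (by omega) (by omega) (by omega) (by omega) (by omega) (by omega) rfl
    rw [hu 1 (by omega) (by omega), hu 2 (by omega) (by omega),
      ceilDiv_eq_one one_pos (by omega), ceilDiv_eq_one two_pos (by omega)] at this
    push_cast at this
    linarith
  have hδ : 0 ≤ u * (a / k : ℕ) + a * δ := by
    have := hsub k (a + 1 - k) 1 (by omega) (by omega) (by omega) (by omega) (by omega)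
      (by omega) (by rw [show k + (a + 1 - k) = a + 1 by omega]; simp)
    rw [hu k (by omega) (by omega), hu (a + 1 - k) (by omega) (by omega),
      hu 1 (by omega) (by omega), ceilDiv_eq_one one_pos (by omega),
      ceilDiv_eq_one (by omega) le_rfl, ceilDiv_add_one_sub (by omega) (by omega),
      Nat.cast_sub (by omega)] at this
    push_cast at this
    linarith
  have ha' : (0 : ℝ) < a := by exact_mod_cast ha
  -- These coefficients solve `α * n + β * (a * ⌈n / k⌉ - q * n) = u * ⌈n / k⌉ + n * δ` with `q = a
  -- / k`.
  refine ⟨(u * (a / k : ℕ) + a * δ) / a, u / a, by positivity, by positivity, ?_⟩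
  funext g
  rw [← hyx _ g (mulIndex_mul ha hgcd g.1),
    hu _ (mulIndex_pos ha hgcd g.2) (mulIndex_lt ha d g.1)]
  simp only [Pi.add_apply, Pi.smul_apply, smul_eq_mul, indexRay, ceilRay]
  field_simp
  ring

theorem linearIndependent_indexRay_ceilRay (hgcd : Int.gcd a d = 1) (hk : 1 < k)
    (hka : k + 2 < a) : LinearIndependent ℝ ![indexRay a d, ceilRay a k d] := by
  rw [LinearIndependent.pair_iff]
  intro α β hαβ
  have ha' : (a : ℝ) ≠ 0 := by
    have : a ≠ 0 := by omega
    exact_mod_cast this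
  have key : ∀ n : ℕ, 0 < n → n ≤ 2 → α * n + β * (a - (a / k : ℕ) * n) = 0 := by
    intro n h0 hn
    have := congrFun hαβ ⟨n * d, natCast_mul_ne_zero hgcd h0 (by omega)⟩
    simp only [Pi.add_apply, Pi.smul_apply, smul_eq_mul, indexRay, ceilRay, Pi.zero_apply] at this
    rwa [mulIndex_natCast_mul hgcd (by omega), ceilDiv_eq_one h0 (by omega), Nat.cast_one,
      mul_one] at this
  have h1 := key 1 one_pos one_le_two
  have h2 := key 2 two_pos le_rfl
  push_cast at h1 h2
  have hβ : β = 0 := by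
    have : β * a = 0 := by linear_combination 2 * h1 - h2
    exact (mul_eq_zero.1 this).resolve_right ha'
  subst hβ
  exact ⟨by linarith, rfl⟩

/-- The separating equation is `1 + 1 = 2`, where `ceilRay` has slack `a`. -/
theorem isConeFace_raySpan_indexRay (hgcd : Int.gcd a d = 1) (hk : 1 < k) (hka : k + 2 < a) :
    IsConeFace (ZMod a) (raySpan (indexRay a d)) := by
  have ha : (a : ℝ) ≠ 0 := by
    have : a ≠ 0 := by omega
    exact_mod_cast this
  have h1 := natCast_mul_ne_zero hgcd one_pos (show 1 < a by omega)
  have hsum : ((1 : ℕ) * d + (1 : ℕ) * d : ZMod a) = ((2 : ℕ) : ZMod a) * d := by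
    push_cast
    ring
  refine isConeFace_raySpan_left (isConeFace_coneSpan_indexRay_ceilRay hgcd hk hka)
    (i := ⟨_, h1⟩) (j := ⟨_, h1⟩)
    (by rw [hsum]; exact natCast_mul_ne_zero hgcd two_pos (by omega)) ?_ ?_
  · simp only [indexRay]
    rw [hsum, mulIndex_natCast_mul hgcd (by omega), mulIndex_natCast_mul hgcd (by omega)]
    norm_num
  · simp only [ceilRay]
    rw [hsum, mulIndex_natCast_mul hgcd (by omega), mulIndex_natCast_mul hgcd (by omega),
      ceilDiv_eq_one one_pos (by omega), ceilDiv_eq_one two_pos (by omega)]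
    push_cast
    intro h
    exact ha (by linear_combination h)

/-- The separating equation is `k + (a + 1 - k) ≡ 1`, where `indexRay` has slack `a`. -/
theorem isConeFace_raySpan_ceilRay (hgcd : Int.gcd a d = 1) (hk : 1 < k) (hka : k + 2 < a) :
    IsConeFace (ZMod a) (raySpan (ceilRay a k d)) := by
  have ha : (a : ℝ) ≠ 0 := by
    have : a ≠ 0 := by omega
    exact_mod_cast this
  have hsum : ((k : ℕ) * d + ((a + 1 - k : ℕ) : ZMod a) * d : ZMod a) = ((1 : ℕ) : ZMod a) * d := by
    rw [← add_mul, ← Nat.cast_add, show k + (a + 1 - k) = a + 1 by omega]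
    simp
  have hF := isConeFace_coneSpan_indexRay_ceilRay hgcd hk hka
  rw [coneSpan_comm] at hF
  refine isConeFace_raySpan_left hF
    (i := ⟨_, natCast_mul_ne_zero hgcd (show 0 < k by omega) (by omega)⟩)
    (j := ⟨_, natCast_mul_ne_zero hgcd (show 0 < a + 1 - k by omega) (by omega)⟩)
    (by rw [hsum]; exact natCast_mul_ne_zero hgcd one_pos (by omega)) ?_ ?_
  · simp only [ceilRay]
    rw [hsum, mulIndex_natCast_mul hgcd (by omega), mulIndex_natCast_mul hgcd (by omega),
      mulIndex_natCast_mul hgcd (by omega), ceilDiv_add_one_sub (by omega) (by omega),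
      ceilDiv_eq_one one_pos (by omega), ceilDiv_eq_one (by omega) le_rfl,
      Nat.cast_sub (by omega)]
    push_cast
    ring
  · simp only [indexRay]
    rw [hsum, mulIndex_natCast_mul hgcd (by omega), mulIndex_natCast_mul hgcd (by omega),
      mulIndex_natCast_mul hgcd (by omega), Nat.cast_sub (by omega)]
    push_cast
    intro h
    exact ha (by linear_combination h)

/-! ### Numerical semigroups on the rays -/

/-- With `a = k * q + 1`, `c = ⌈n / k⌉` and `s = k * c - n`, the coordinate `a * c - q * n` equals
`c + q * s`. This is below `a`, and `k` times it is `n + a * s`, so it is the index of the same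
residue with respect to `k * d`. -/
theorem ceilRay_eq_indexRay (hgcd : Int.gcd a d = 1) (hk : 1 < k) (hka : k < a)
    (hdvd : k ∣ a - 1) (hgcd' : Int.gcd a (k * d) = 1) :
    ceilRay a k d = indexRay a (k * d) := by
  obtain ⟨q, hq⟩ := hdvd
  have ha : a = k * q + 1 := by omega
  have hq' : a / k = q := by
    rw [ha, Nat.mul_add_div (by omega), Nat.div_eq_of_lt hk, add_zero]
  funext g
  have hn := mulIndex_lt (by omega) d g.1
  have hg := mulIndex_mul (by omega) hgcd g.1
  simp only [ceilRay, indexRay]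
  rw [hq']
  generalize mulIndex a d g.1 = n at *
  have hc : n ⌈/⌉ k ≤ q := (ceilDiv_le_iff_le_mul (by omega)).2 (by omega)
  have hc1 : n ≤ k * (n ⌈/⌉ k) := (ceilDiv_le_iff_le_mul (by omega)).1 le_rfl
  have hc2 : k * (n ⌈/⌉ k) ≤ n + k - 1 := by
    rw [Nat.ceilDiv_eq_add_pred_div]
    exact Nat.mul_div_le _ _
  generalize n ⌈/⌉ k = c at *
  obtain ⟨s, hs⟩ := Nat.exists_eq_add_of_le hc1
  have hlt : c + q * s < a := by
    have : q * s ≤ q * (k - 1) := Nat.mul_le_mul_left q (by omega)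
    have h2 : q * (k - 1) + q = q * k := by
      rw [← Nat.mul_succ, Nat.succ_eq_add_one, Nat.sub_add_cancel (by omega)]
    rw [mul_comm] at h2
    rw [ha, mul_comm k q, ← h2, mul_comm (k - 1) q]
    omega
  have hmul : ((c + q * s : ℕ) : ZMod a) * ((k * d : ℤ) : ZMod a) = g.1 := by
    have h1 : (c + q * s) * k = n + a * s := by
      rw [ha, add_mul, mul_comm c k, hs]
      ring
    have h2 := congrArg (Nat.cast : ℕ → ZMod a) h1
    rw [Nat.cast_mul, Nat.cast_add n, Nat.cast_mul a, ZMod.natCast_self, zero_mul,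
      add_zero] at h2
    rw [Int.cast_mul, Int.cast_natCast, ← mul_assoc, h2, hg]
  rw [← hmul, mulIndex_natCast_mul hgcd' hlt]
  have hsr : (k * c : ℝ) = n + s := by exact_mod_cast hs
  rw [ha]
  push_cast
  linear_combination q * hsr

/-- The Apéry coordinates of `⟨a, b⟩`. -/
theorem aperyTuple_closure_pair {b : ℕ} (ha : 0 < a) (hgcd : Int.gcd a b = 1) :
    IsNumericalSemigroup (AddSubmonoid.closure {a, b}) ∧
      a ∈ AddSubmonoid.closure ({a, b} : Set ℕ) ∧
      aperyTuple a (AddSubmonoid.closure {a, b}) = (b : ℝ) • indexRay a b := by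
  -- The degenerate parameters `h = 0`, `k = 1` turn the general Apéry formula into `n * b`.
  have hcl : AddSubmonoid.closure ({a, b} : Set ℕ) = arithSemigroup a 0 1 b := by
    rw [arithSemigroup]
    congr 1
    ext n
    simp only [arithGens, Set.mem_insert_iff, Set.mem_singleton_iff, Set.mem_ofPred_eq]
    refine or_congr_right ⟨?_, ?_⟩
    · rintro rfl
      exact ⟨1, le_rfl, le_rfl, by simp⟩
    · rintro ⟨i, hi, hi', hn⟩
      obtain rfl : i = 1 := le_antisymm hi' hi
      push_cast at hn
      omega
  rw [hcl]
  refine ⟨isNumericalSemigroup_arithSemigroup ha one_pos hgcd (by simp),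
    self_mem_arithSemigroup _ _ _ _, ?_⟩
  funext g
  have h := aperyCoord_arithSemigroup (h := 0) ha one_pos hgcd (by simp) (by simp) g.1
  have h' := congrArg (Int.cast : ℤ → ℝ) h
  push_cast at h'
  simp only [aperyTuple, Pi.smul_apply, smul_eq_mul, indexRay]
  rw [h']
  ring

theorem faceContains_raySpan_closure_pair {b : ℕ} (ha : 0 < a) (hgcd : Int.gcd a d = 1)
    (hb : 0 < b) (hbd : (b : ℤ) ≡ d [ZMOD a])
    (hF : IsConeFace (ZMod a) (raySpan (indexRay a d))) :
    FaceContains a (raySpan (indexRay a d)) (AddSubmonoid.closure {a, b}) := by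
  have hgcd' : Int.gcd a b = 1 := by
    obtain ⟨c, hc⟩ := hbd.symm.dvd
    rw [show (b : ℤ) = d + c * a by linear_combination hc, Int.gcd_add_mul_right_right, hgcd]
  obtain ⟨h1, h2, h3⟩ := aperyTuple_closure_pair ha hgcd'
  have hb' : (0 : ℝ) < b := by exact_mod_cast hb
  have hcast : ((b : ℤ) : ZMod a) = d := (ZMod.intCast_eq_intCast_iff _ _ _).2 hbd
  refine ⟨hF, h1, h2, ?_⟩
  rw [h3, indexRay_congr hcast]
  exact mem_relInterior_of_forall_subset ⟨b, hb'.le, rfl⟩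
    fun F' hF' h => raySpan_subset hF' (hF'.mem_of_smul_mem hb' h)

/-- A numerical semigroup on the ray through `indexRay a d` is generated by `a` and its Apéry
element in the residue class of `d`. -/
theorem eq_closure_pair_of_faceContains {T : AddSubmonoid ℕ} (ha : 1 < a)
    (hgcd : Int.gcd a d = 1) (hT : FaceContains a (raySpan (indexRay a d)) T) :
    ∃ b : ℕ, 0 < b ∧ (b : ℤ) ≡ d [ZMOD a] ∧ T = AddSubmonoid.closure {a, b} := by
  have ha0 : 0 < a := by omega
  obtain ⟨-, hTn, haT, ⟨c, -, hc⟩, -⟩ := hT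
  have hd : (d : ZMod a) ≠ 0 := by simpa using natCast_mul_ne_zero hgcd one_pos ha
  have hidx : mulIndex a d (d : ZMod a) = 1 := by
    simpa using mulIndex_natCast_mul hgcd ha
  have hbspec := aperyCoord_spec ha0 hTn haT (d : ZMod a)
  have hcb := congrFun hc ⟨d, hd⟩
  simp only [aperyTuple, Pi.smul_apply, smul_eq_mul, indexRay] at hcb
  rw [hidx, Nat.cast_one, mul_one] at hcb
  generalize aperyCoord a T (d : ZMod a) = b at *
  refine ⟨b, Nat.pos_of_ne_zero ?_, ?_, le_antisymm (fun x hx => ?_) ?_⟩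
  · rintro rfl
    exact hd (by rw [← hbspec.2]; simp)
  · rw [← ZMod.intCast_eq_intCast_iff, ← hbspec.2]
    simp
  · have haC : a ∈ AddSubmonoid.closure ({a, b} : Set ℕ) :=
      AddSubmonoid.subset_closure (Or.inl rfl)
    have hbC : b ∈ AddSubmonoid.closure ({a, b} : Set ℕ) :=
      AddSubmonoid.subset_closure (Or.inr rfl)
    by_cases hx0 : (x : ZMod a) = 0
    · exact mem_of_natCast_eq haC (zero_mem _) (Nat.zero_le x) (by rw [hx0]; simp)
    · have hcx := congrFun hc ⟨x, hx0⟩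
      simp only [aperyTuple, Pi.smul_apply, smul_eq_mul, indexRay] at hcx
      -- On the ray, the Apéry element in the class of `n * d` is `n * b`, so `a` and `b` generate
      -- everything.
      rw [← hcb, mul_comm] at hcx
      norm_cast at hcx
      refine mem_of_natCast_eq haC ?_ (aperyCoord_le ha0 hTn haT hx)
        (aperyCoord_spec ha0 hTn haT _).2
      rw [hcx, ← smul_eq_mul]
      exact nsmul_mem hbC _
  · rw [AddSubmonoid.closure_le]
    rintro x (rfl | rfl)
    · exact haT
    · exact hbspec.1.1

/-! ### Shifted parameters, Kunz tuples and the decomposition of the Apéry tuple -/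

theorem IsExtraGenArith.mul_add_mul_pos (hS : IsExtraGenArith a h k d) :
    0 < (a * h + k * d : ℤ) := by
  have := hS.lt_last
  omega

theorem IsExtraGenArith.add_self (hS : IsExtraGenArith a h k d) :
    IsExtraGenArith a h k (d + a) where
  one_le_a := hS.one_le_a
  one_le_h := hS.one_le_h
  one_le_k := hS.one_le_k
  k_lt_a := hS.k_lt_a
  gcd_eq_one := by simpa using hS.gcd_eq_one
  lt_last := by
    have h1 := hS.lt_last
    have h2 : (0 : ℤ) ≤ k * a := by positivity
    linarith

theorem IsExtraGenArith.sub_mul_div (hS : IsExtraGenArith a h k d) :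
    IsExtraGenArith a (h + a) k (d - a * ((a / k : ℕ) : ℤ)) where
  one_le_a := hS.one_le_a
  one_le_h := hS.one_le_h.trans (Nat.le_add_right _ _)
  one_le_k := hS.one_le_k
  k_lt_a := hS.k_lt_a
  gcd_eq_one := by simpa using hS.gcd_eq_one
  lt_last := by
    have h1 := hS.lt_last
    have h2 : (k * (a / k : ℕ) : ℤ) ≤ a := by exact_mod_cast Nat.mul_div_le a k
    have h3 := mul_le_mul_of_nonneg_left h2 (Int.natCast_nonneg a)
    push_cast at h3 ⊢
    linarith

theorem isKunzTupleOf_add_indexRay (hS : IsExtraGenArith a h k d)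
    (hq : 0 ≤ ((a / k : ℕ) * h + d : ℤ)) :
    IsKunzTupleOf a (kunzTuple a (arithSemigroup a h k d) + indexRay a d)
      (arithSemigroup a h k (d + a)) := by
  have hS' := hS.add_self
  refine ⟨isNumericalSemigroup_arithSemigroup hS.one_le_a hS.one_le_k hS'.gcd_eq_one
    hS'.mul_add_mul_pos.le, self_mem_arithSemigroup _ _ _ _, funext fun g => ?_⟩
  have ha : (a : ℝ) ≠ 0 := by
    have := hS.one_le_a
    positivity
  have h1 := congrArg (Int.cast : ℤ → ℝ) (aperyCoord_arithSemigroup hS.one_le_a hS.one_le_k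
    hS.gcd_eq_one hS.mul_add_mul_pos.le hq g.1)
  have h2 := congrArg (Int.cast : ℤ → ℝ) (aperyCoord_arithSemigroup hS.one_le_a hS.one_le_k
    hS'.gcd_eq_one hS'.mul_add_mul_pos.le (by omega) g.1)
  rw [mulIndex_congr (d := d + a) (d' := d) (by simp)] at h2
  push_cast at h1 h2
  simp only [kunzTuple, Pi.add_apply, indexRay]
  rw [h1, h2]
  field_simp
  ring

theorem isKunzTupleOf_add_ceilRay (hS : IsExtraGenArith a h k d)
    (hq : 0 ≤ ((a / k : ℕ) * h + d : ℤ)) :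
    IsKunzTupleOf a (kunzTuple a (arithSemigroup a h k d) + ceilRay a k d)
      (arithSemigroup a (h + a) k (d - a * ((a / k : ℕ) : ℤ))) := by
  have hS' := hS.sub_mul_div
  refine ⟨isNumericalSemigroup_arithSemigroup hS.one_le_a hS.one_le_k hS'.gcd_eq_one
    hS'.mul_add_mul_pos.le, self_mem_arithSemigroup _ _ _ _, funext fun g => ?_⟩
  have ha : (a : ℝ) ≠ 0 := by
    have := hS.one_le_a
    positivity
  have h1 := congrArg (Int.cast : ℤ → ℝ) (aperyCoord_arithSemigroup hS.one_le_a hS.one_le_k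
    hS.gcd_eq_one hS.mul_add_mul_pos.le hq g.1)
  have h2 := congrArg (Int.cast : ℤ → ℝ) (aperyCoord_arithSemigroup hS.one_le_a hS.one_le_k
    hS'.gcd_eq_one hS'.mul_add_mul_pos.le
    -- With `q = a / k`, the shift leaves the bound unchanged: `q * (h + a) + (d - a * q) = q * h +
    -- d`.
    (by rw [Nat.cast_add, mul_add, mul_comm (a : ℤ)]; linarith) g.1)
  rw [mulIndex_congr (d := d - a * ((a / k : ℕ) : ℤ)) (d' := d) (by simp)] at h2
  simp only [kunzTuple, Pi.add_apply, ceilRay]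
  generalize a / k = q at *
  push_cast at h1 h2
  rw [h1, h2]
  field_simp
  ring

theorem aperyTuple_arithSemigroup (hS : IsExtraGenArith a h k d)
    (hq : 0 ≤ ((a / k : ℕ) * h + d : ℤ)) :
    aperyTuple a (arithSemigroup a h k d) =
      ((a / k : ℕ) * h + d : ℝ) • indexRay a d + (h : ℝ) • ceilRay a k d := by
  funext g
  have h1 := congrArg (Int.cast : ℤ → ℝ) (aperyCoord_arithSemigroup hS.one_le_a hS.one_le_k
    hS.gcd_eq_one hS.mul_add_mul_pos.le hq g.1)
  push_cast at h1
  simp only [aperyTuple, Pi.add_apply, Pi.smul_apply, smul_eq_mul, indexRay, ceilRay]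
  rw [h1]
  ring

end Rays

/-! ### The main theorem -/

theorem theoremt (a h k : ℕ) (d : ℤ) (hS : IsExtraGenArith a h k d)
    (hmin : IsMinimalGenSet (arithGens a h k d)) (hk : 1 < k) (hka : k + 2 < a) :
    (∃! F : Set ({g : ZMod a // g ≠ 0} → ℝ), FaceContains a F (arithSemigroup a h k d)) ∧
    ∀ F : Set ({g : ZMod a // g ≠ 0} → ℝ), FaceContains a F (arithSemigroup a h k d) →
      faceDim F = 2 ∧
      IsExtraGenArith a h k (d + a) ∧
      IsExtraGenArith a (h + a) k (d - a * ((a / k : ℕ) : ℤ)) ∧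
      ∃ r t : {g : ZMod a // g ≠ 0} → ℝ,
        IsKunzTupleOf a (kunzTuple a (arithSemigroup a h k d) + r)
          (arithSemigroup a h k (d + a)) ∧
        IsKunzTupleOf a (kunzTuple a (arithSemigroup a h k d) + t)
          (arithSemigroup a (h + a) k (d - a * ((a / k : ℕ) : ℤ))) ∧
        raySpan r ≠ raySpan t ∧
        (∀ R, IsExtremalRay (ZMod a) F R ↔ R = raySpan r ∨ R = raySpan t) ∧
        (∀ b : ℕ, 0 < b → (b : ℤ) ≡ d [ZMOD a] →
          FaceContains a (raySpan r) (AddSubmonoid.closure {a, b})) ∧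
        (k ∣ a - 1 →
          (∃ T : AddSubmonoid ℕ, FaceContains a (raySpan t) T) ∧
          ∀ T : AddSubmonoid ℕ, FaceContains a (raySpan t) T →
            ∃ b : ℕ, 0 < b ∧ (b : ℤ) ≡ k * d [ZMOD a] ∧ T = AddSubmonoid.closure {a, b}) := by
  have ha : 0 < a := by omega
  have hgcd := hS.gcd_eq_one
  have hq := hS.div_mul_add_pos hmin hk
  have hq' : (0 : ℝ) < (a / k : ℕ) * h + d := by
    have := Int.cast_pos (R := ℝ).2 hq
    push_cast at this
    exact this
  have hh : (0 : ℝ) < h := by exact_mod_cast hS.one_le_h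
  have hFace := isConeFace_coneSpan_indexRay_ceilRay hgcd hk hka
  have hr := isConeFace_raySpan_indexRay hgcd hk hka
  have ht := isConeFace_raySpan_ceilRay hgcd hk hka
  have hrt := linearIndependent_indexRay_ceilRay hgcd hk hka
  have hA := aperyTuple_arithSemigroup hS hq.le
  have hAmem : aperyTuple a (arithSemigroup a h k d) ∈
      coneSpan (indexRay a d) (ceilRay a k d) := ⟨_, _, hq'.le, hh.le, hA⟩
  have hAmin : ∀ F', IsConeFace (ZMod a) F' → aperyTuple a (arithSemigroup a h k d) ∈ F' →
      coneSpan (indexRay a d) (ceilRay a k d) ⊆ F' := fun F' hF' hAF' => by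
    rw [hA] at hAF'
    exact coneSpan_subset_of_mem (indexRay_mem_groupCone ha d)
      (ceilRay_mem_groupCone ha hS.one_le_k d) hq' hh hF' hAF'
  have huniq : ∀ F, FaceContains a F (arithSemigroup a h k d) →
      F = coneSpan (indexRay a d) (ceilRay a k d) := fun F hF =>
    eq_of_mem_relInterior hFace hAmem hAmin hF.1 hF.2.2.2
  refine ⟨⟨_, ⟨hFace, isNumericalSemigroup_arithSemigroup ha hS.one_le_k hgcd
    hS.mul_add_mul_pos.le, self_mem_arithSemigroup _ _ _ _,
    mem_relInterior_of_forall_subset hAmem hAmin⟩, huniq⟩, fun F hF => ?_⟩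
  rw [huniq F hF]
  refine ⟨faceDim_coneSpan hrt, hS.add_self, hS.sub_mul_div, indexRay a d, ceilRay a k d,
    isKunzTupleOf_add_indexRay hS hq.le, isKunzTupleOf_add_ceilRay hS hq.le,
    raySpan_ne_raySpan hrt, fun R => isExtremalRay_coneSpan_iff hrt hr ht,
    fun b hb hbd => faceContains_raySpan_closure_pair ha hgcd hb hbd hr, fun hdvd => ?_⟩
  have hgcdk : Int.gcd a (k * d) = 1 := by
    obtain ⟨q, hq⟩ := hdvd
    rw [← Int.isCoprime_iff_gcd_eq_one] at hgcd ⊢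
    -- Bézout for `a` and `k`: `a - q * k = 1`.
    refine IsCoprime.mul_right ⟨1, -q, ?_⟩ hgcd
    have : (a : ℤ) = k * q + 1 := by
      have : a = k * q + 1 := by omega
      exact_mod_cast this
    rw [this]
    ring
  rw [ceilRay_eq_indexRay hgcd hk hS.k_lt_a hdvd hgcdk] at ht ⊢
  refine ⟨?_, fun T hT => eq_closure_pair_of_faceContains (by omega) hgcdk hT⟩
  have ha' : (0 : ℤ) < a := by exact_mod_cast ha
  -- Any positive representative of `k * d` modulo `a` will do; adding `a` to the remainder makes
  -- positivity immediate.
  obtain ⟨b, hb⟩ := Int.eq_ofNat_of_zero_le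
    (add_nonneg (Int.emod_nonneg (k * d) ha'.ne') ha'.le)
  refine ⟨_, faceContains_raySpan_closure_pair (b := b) ha hgcdk ?_ ?_ ht⟩
  · have := Int.emod_nonneg (k * d) ha'.ne'
    omega
  · rw [← hb]
    exact Int.add_modEq_right.trans (Int.mod_modEq _ _)
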